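/- Let $f$ be a monic complex polynomial of degree $n\ge 2$, let $1\le p\le\infty$ and $1/p+1/q=1$, and let $\|\cdot\|_p$ be the usual $p$-norm on $\mathbb{C}^n$. For $z\in\mathbb{C}^n$ with distinct components and $i=1,\dots,n$ put $$W_i(z)=\frac{f(z_i)}{\prod_{j\ne i}(z_i-z_j)},\qquad d_i(z)=\min_{j\ne i}|z_i-z_j|,\qquad E(z)=\Bigl\|\Bigl(\frac{W_1(z)}{d_1(z)},\dots,\frac{W_n(z)}{d_n(z)}\Bigr)\Bigr\|_p ,$$ and $W(z)=(W_1(z),\dots,W_n(z))$. Nourein's iteration is $z^{k+1}=G(z^k)$, $k=0,1,2,\dots$, where $$G_i(z)=z_i-\frac{W_i(z)}{1+\sum_{j\ne i}W_j(z)/(z_i-z_j-W_i(z))}\qquad(i=1,\dots,n).$$ A root-vector of $f$ is a vector $\xi\in\mathbb{C}^n$ whose components are exactly the zeros of $f$ with their multiplicities. Let $a=(n-1)^{1/q}$, $b=2^{1/q}$, $m=a+b+1$, and $$\phi(x)=\frac{a^2x^3}{(1-mx+bx^2)(1-(a+2)x+x^2)}\Bigl(1+\frac1{n-1}\cdot\frac{a(x-x^2)}{1-mx+bx^2}\Bigr)^{n-1},$$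 $$\psi(x)=\frac{1-mx+bx^2}{1-(a+1)x},\qquad \mu(x)=\frac{1-x}{1-(a+1)x}.$$ Suppose that $z^0\in\mathbb{C}^n$ has distinct components and satisfies $$E(z^0)<\frac{2}{m+\sqrt{m^2-4b}}\quad\text{and}\quad \phi(E(z^0))\le 1 .$$ Then the following statements hold. (i) Nourein's sequence $(z^k)$ is well defined (every $z^k$ has distinct components and all denominators in $G(z^k)$ are nonzero) and converges to a root-vector $\xi$ of $f$. If $\phi(E(z^0))<1$, the convergence is of order (at least) four: there is a constant $C$ with $\|z^{k+1}-\xi\|_p\le C\,\|z^k-\xi\|_p^4$ for all $k\ge0$. (ii) For each $k\ge1$, $$\|z^k-\xi\|_p\le \mu_k\,\frac{\theta^k\lambda^{(4^k-1)/3}}{1-\theta\lambda^{4^k}}\,\|W(z^0)\|_p ,$$ where $\lambda=\phi(E(z^0))$, $\theta=\psi(E(z^0))$, $\mu_k=\mu\bigl(E(z^0)\lambda^{(4^k-1)/3}\bigr)$, and $1-\theta\lambda^{4^k}>0$. (iii) For each $k\ge0$, $$\|z^k-\xi\|_p\le \frac{\mu_k}{1-\theta_k\lambda_k}\,\|W(z^k)\|_p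 ,$$ where now $\lambda_k=\phi(E(z^k))$, $\theta_k=\psi(E(z^k))$, $\mu_k=\mu(E(z^k))$, and $E(z^k)<2/(m+\sqrt{m^2-4b})$, $1-\theta_k\lambda_k>0$. -/

import Mathlib

open Polynomial Filter Topology
open scoped ENNReal

noncomputable section

namespace Nourein

/-- The norm `‖z‖_p` on `ℂⁿ`, `1 ≤ p ≤ ∞`. -/
def pnorm {n : ℕ} (p : ℝ≥0∞) (z : Fin n → ℂ) : ℝ := ‖WithLp.toLp p z‖

/-- `ξ` is a root-vector of `f`: its components are exactly the zeros of `f`,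
counted with multiplicities. -/
def IsRootVector {n : ℕ} (f : ℂ[X]) (ξ : Fin n → ℂ) : Prop :=
  f.roots = Finset.univ.val.map ξ

/-- The Weierstrass correction `W_i(z) = f(z_i) / ∏_{j ≠ i} (z_i - z_j)`. -/
def W {n : ℕ} (f : ℂ[X]) (z : Fin n → ℂ) (i : Fin n) : ℂ :=
  f.eval (z i) / ∏ j ∈ Finset.univ.erase i, (z i - z j)

/-- `d_i(z) = min {|z_i - z_j| : j ≠ i}` (a minimum over a finite set, nonempty for `n ≥ 2`). -/
def d {n : ℕ} (z : Fin n → ℂ) (i : Fin n) : ℝ :=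
  ⨅ j : {j : Fin n // j ≠ i}, ‖z i - z j‖

/-- `E(z) = ‖W(z) / d(z)‖_p`, the quotient being taken componentwise. -/
def E {n : ℕ} (p : ℝ≥0∞) (f : ℂ[X]) (z : Fin n → ℂ) : ℝ :=
  pnorm p (fun i => W f z i / (d z i : ℂ))

/-- The denominator `1 + ∑_{j ≠ i} W_j(z) / (z_i - z_j - W_i(z))` of the Nourein map. -/
def den {n : ℕ} (f : ℂ[X]) (z : Fin n → ℂ) (i : Fin n) : ℂ :=
  1 + ∑ j ∈ Finset.univ.erase i, W f z j / (z i - z j - W f z i)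

/-- The Nourein map `G`. -/
def G {n : ℕ} (f : ℂ[X]) (z : Fin n → ℂ) : Fin n → ℂ :=
  fun i => z i - W f z i / den f z i

/-- All divisions that occur in `G(z)` are by nonzero numbers. -/
def IsDefinedAt {n : ℕ} (f : ℂ[X]) (z : Fin n → ℂ) : Prop :=
  Function.Injective z ∧ (∀ i j, j ≠ i → z i - z j - W f z i ≠ 0) ∧ ∀ i, den f z i ≠ 0

/-- The iterates `z^0 = z0`, `z^{k+1} = G(z^k)`. -/
def iter {n : ℕ} (f : ℂ[X]) (z0 : Fin n → ℂ) : ℕ → Fin n → ℂ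
  | 0 => z0
  | k + 1 => G f (iter f z0 k)

/-- The sequence `u` converges to `ξ` with order (at least) `r`, in the quotient sense. -/
def ConvergesWithOrder {n : ℕ} (p : ℝ≥0∞) (r : ℕ) (u : ℕ → Fin n → ℂ) (ξ : Fin n → ℂ) : Prop :=
  Tendsto u atTop (𝓝 ξ) ∧
    ∃ C : ℝ, ∀ k, pnorm p (u (k + 1) - ξ) ≤ C * pnorm p (u k - ξ) ^ r

/-- `a = (n - 1)^{1/q}`. -/
def a (n : ℕ) (q : ℝ≥0∞) : ℝ := ((n : ℝ) - 1) ^ (1 / q).toReal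

/-- `b = 2^{1/q}`. -/
def b (q : ℝ≥0∞) : ℝ := (2 : ℝ) ^ (1 / q).toReal

/-- `m = a + b + 1`. -/
def m (n : ℕ) (q : ℝ≥0∞) : ℝ := a n q + b q + 1

/-- The radius `2 / (m + √(m² - 4b))`. -/
def R (n : ℕ) (q : ℝ≥0∞) : ℝ := 2 / (m n q + √(m n q ^ 2 - 4 * b q))

def phi (n : ℕ) (q : ℝ≥0∞) (x : ℝ) : ℝ :=
  a n q ^ 2 * x ^ 3 /
      ((1 - m n q * x + b q * x ^ 2) * (1 - (a n q + 2) * x + x ^ 2)) *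
    (1 + 1 / ((n : ℝ) - 1) *
      (a n q * (x - x ^ 2) / (1 - m n q * x + b q * x ^ 2))) ^ (n - 1)

def psi (n : ℕ) (q : ℝ≥0∞) (x : ℝ) : ℝ :=
  (1 - m n q * x + b q * x ^ 2) / (1 - (a n q + 1) * x)

def mu (n : ℕ) (q : ℝ≥0∞) (x : ℝ) : ℝ :=
  (1 - x) / (1 - (a n q + 1) * x)

end Nourein

end

/-!
Write `x = E(z)`, and `W_i`, `d_i` for the Weierstrass corrections and the distances at `z`. All
estimates are made for the single components; they pass to the `p`-norm because it is monotone
(`pnorm_le_mul`). The exponent `p` itself enters only through Hölder's inequality: a sum of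
`|W_j| / d_j` over all `j ≠ i` is at most `a x`, a sum of two of them at most `b x`.

One step `z ↦ G(z)` moves the `i`-th component by at most `μ(x) |W_i|` and shrinks no distance
between two components by more than the factor `ψ(x) = 1 - b x μ(x)`. In the Lagrange form
`f(t) = ∏ (t - z_j) · (1 + ∑ W_k / (t - z_k))` the second factor at `t = G_i(z)` collapses to
`(t - z_i) · ∑_{j ≠ i} W_j / (z_i - z_j - W_i) · ∑_{j ≠ i} W_j / ((t - z_j) (z_i - z_j - W_i))`
(`W_G_eq`), and the inequality of arithmetic and geometric means bounds the remaining product. The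
outcome is `|W_i(G(z))| ≤ ψ(x) φ(x) |W_i|` and `E(G(z)) ≤ φ(x) x` (`norm_W_G_le`, `E_G_le`).

Both `φ` and `ψ φ` are `x³` times an increasing function, so by induction,
with `λ = φ(E(z^0))` and `θ = ψ(E(z^0))`, one has `E(z^k) ≤ E(z^0) λ^((4^k - 1)/3)` and
`|W_i(z^k)| ≤ θ^k λ^((4^k - 1)/3) |W_i(z^0)|`. The steps from `z^k`
on are dominated by a geometric series with quotient `θ λ^(4^k) < 1`. This gives the limit `ξ` and
the a priori estimate (`norm_iter_sub_le`), whose case `k = 0`, applied at `z^k`, is the a posteriori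
estimate (`norm_sub_lim_le`). The Lagrange form of `f` at the nodes `z^k` tends to `∏ (t - ξ_j)`, so
`ξ` is a root-vector, whether or not its components are distinct.

If `λ < 1`, the a posteriori estimate separates the components of `ξ` (`injective_of_tendsto`). Then
the `1 / d_i(z^k)` are bounded, `|W_i(z^k)|` and `E(z^k)` are `O(‖z^k - ξ‖)`, and
`|z^{k+1}_i - ξ_i| = O(|W_i(z^{k+1})|) = O(E(z^k)³ |W_i(z^k)|)` is of order four.
-/

namespace Nourein

/-! ### The `p`-norm and Hölder's inequality -/

lemma norm_apply_le_pnorm {n : ℕ} {p : ℝ≥0∞} (hp : 1 ≤ p) (z : Fin n → ℂ) (i : Fin n) :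
    ‖z i‖ ≤ pnorm p z :=
  have : Fact (1 ≤ p) := ⟨hp⟩
  PiLp.norm_apply_le (WithLp.toLp p z) i

lemma pnorm_nonneg {n : ℕ} {p : ℝ≥0∞} (hp : 1 ≤ p) (z : Fin n → ℂ) : 0 ≤ pnorm p z :=
  have : Fact (1 ≤ p) := ⟨hp⟩
  norm_nonneg (WithLp.toLp p z)

lemma pnorm_eq_sum {n : ℕ} {p : ℝ≥0∞} (hp : 1 ≤ p) (htop : p ≠ ∞) (z : Fin n → ℂ) :
    pnorm p z = (∑ i, ‖z i‖ ^ p.toReal) ^ (1 / p.toReal) :=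
  PiLp.norm_eq_sum (ENNReal.toReal_pos (zero_lt_one.trans_le hp).ne' htop) (WithLp.toLp p z)

/-- The `p`-norm is monotone in the moduli of the components. Through this lemma all estimates of
vectors follow from estimates of their components. -/
lemma pnorm_le_mul {n : ℕ} {p : ℝ≥0∞} (hp : 1 ≤ p) {v w : Fin n → ℂ} {c : ℝ} (hc : 0 ≤ c)
    (h : ∀ i, ‖v i‖ ≤ c * ‖w i‖) : pnorm p v ≤ c * pnorm p w := by
  rcases eq_or_ne p ∞ with rfl | htop
  · refine (PiLp.norm_eq_ciSup (WithLp.toLp ∞ v)).trans_le (Real.iSup_le (fun i => ?_)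
      (mul_nonneg hc (pnorm_nonneg hp w)))
    exact (h i).trans (mul_le_mul_of_nonneg_left (norm_apply_le_pnorm hp w i) hc)
  · have hp0 : 0 < p.toReal := ENNReal.toReal_pos (zero_lt_one.trans_le hp).ne' htop
    rw [pnorm_eq_sum hp htop, pnorm_eq_sum hp htop]
    calc (∑ i, ‖v i‖ ^ p.toReal) ^ (1 / p.toReal)
        ≤ (∑ i, (c * ‖w i‖) ^ p.toReal) ^ (1 / p.toReal) := by
          gcongr with i
          exact h i
      _ = (c ^ p.toReal * ∑ i, ‖w i‖ ^ p.toReal) ^ (1 / p.toReal) := by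
          rw [Finset.mul_sum]
          congr 1
          exact Finset.sum_congr rfl fun i _ => Real.mul_rpow hc (norm_nonneg _)
      _ = c * (∑ i, ‖w i‖ ^ p.toReal) ^ (1 / p.toReal) := by
          rw [Real.mul_rpow (by positivity) (by positivity), ← Real.rpow_mul hc,
            mul_one_div_cancel hp0.ne', Real.rpow_one]

/-- Hölder's inequality for the sum of the moduli of some components. -/
lemma sum_norm_le_card_rpow_mul_pnorm {n : ℕ} {p q : ℝ≥0∞} (hp : 1 ≤ p) (hpq : 1 / p + 1 / q = 1)
    (s : Finset (Fin n)) (v : Fin n → ℂ) :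
    ∑ i ∈ s, ‖v i‖ ≤ (s.card : ℝ) ^ (1 / q).toReal * pnorm p v := by
  have hp1 : 1 / p ≠ ∞ := fun h => by simp [h] at hpq
  have hq1 : 1 / q ≠ ∞ := fun h => by simp [h] at hpq
  have hreal : (1 / p).toReal + (1 / q).toReal = 1 := by
    rw [← ENNReal.toReal_add hp1 hq1, hpq, ENNReal.toReal_one]
  rcases eq_or_ne p ∞ with rfl | htop
  · have hq : (1 / q).toReal = 1 := by simpa using hreal
    rw [hq, Real.rpow_one, ← nsmul_eq_mul]
    exact Finset.sum_le_card_nsmul _ _ _ fun i _ => norm_apply_le_pnorm hp v i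
  · have hp0 : 0 < p.toReal := ENNReal.toReal_pos (zero_lt_one.trans_le hp).ne' htop
    have hp1 : 1 ≤ p.toReal := by
      simpa using (ENNReal.toReal_le_toReal ENNReal.one_ne_top htop).2 hp
    have hq : (1 / q).toReal = (p.toReal - 1) * (1 / p.toReal) := by
      have : (1 / p).toReal = 1 / p.toReal := by simp
      rw [this] at hreal
      field_simp at hreal ⊢
      linarith
    have h1 := Real.rpow_sum_le_const_mul_sum_rpow_of_nonneg s (f := fun i => ‖v i‖) hp1
      (fun i _ => norm_nonneg _)
    have h2 : ∑ i ∈ s, ‖v i‖ ^ p.toReal ≤ ∑ i, ‖v i‖ ^ p.toReal :=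
      Finset.sum_le_sum_of_subset_of_nonneg (Finset.subset_univ s) fun i _ _ => by positivity
    rw [pnorm_eq_sum hp htop, hq, Real.rpow_mul (by positivity), ← Real.mul_rpow (by positivity)
      (by positivity)]
    calc ∑ i ∈ s, ‖v i‖ = ((∑ i ∈ s, ‖v i‖) ^ p.toReal) ^ (1 / p.toReal) := by
          rw [← Real.rpow_mul (by positivity), mul_one_div_cancel hp0.ne', Real.rpow_one]
      _ ≤ _ := by
          refine Real.rpow_le_rpow (by positivity) (h1.trans ?_) (by positivity)
          gcongr

lemma sum_erase_norm_le {n : ℕ} (hn : 2 ≤ n) {p q : ℝ≥0∞} (hp : 1 ≤ p) (hpq : 1 / p + 1 / q = 1)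
    (v : Fin n → ℂ) (i : Fin n) :
    ∑ j ∈ Finset.univ.erase i, ‖v j‖ ≤ a n q * pnorm p v := by
  have h := sum_norm_le_card_rpow_mul_pnorm hp hpq (Finset.univ.erase i) v
  rwa [Finset.card_erase_of_mem (Finset.mem_univ i), Finset.card_univ, Fintype.card_fin,
    Nat.cast_sub (by omega), Nat.cast_one] at h

lemma norm_add_norm_le {n : ℕ} {p q : ℝ≥0∞} (hp : 1 ≤ p) (hpq : 1 / p + 1 / q = 1)
    (v : Fin n → ℂ) {i j : Fin n} (hij : i ≠ j) : ‖v i‖ + ‖v j‖ ≤ b q * pnorm p v := by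
  have h := sum_norm_le_card_rpow_mul_pnorm hp hpq {i, j} v
  rwa [Finset.card_pair hij, Finset.sum_pair hij] at h

/-- The inequality of arithmetic and geometric means in product form. -/
lemma prod_one_add_le {ι : Type*} (s : Finset ι) (hs : s.Nonempty) (u : ι → ℝ)
    (hu : ∀ i ∈ s, 0 ≤ u i) :
    ∏ i ∈ s, (1 + u i) ≤ (1 + 1 / (s.card : ℝ) * ∑ i ∈ s, u i) ^ s.card := by
  have hc : 0 < (s.card : ℝ) := by exact_mod_cast hs.card_pos
  have hpos : 0 ≤ ∏ i ∈ s, (1 + u i) :=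
    Finset.prod_nonneg fun i hi => by linarith [hu i hi]
  have h := Real.geom_mean_le_arith_mean s (fun _ => 1) (fun i => 1 + u i)
    (fun _ _ => zero_le_one) (by simpa using hc) (fun i hi => by linarith [hu i hi])
  simp only [Real.rpow_one, Finset.sum_const, nsmul_eq_mul, mul_one, one_mul,
    Finset.sum_add_distrib] at h
  have h2 := pow_le_pow_left₀ (by positivity) h s.card
  rw [← Real.rpow_natCast, ← Real.rpow_mul hpos, inv_mul_cancel₀ hc.ne', Real.rpow_one] at h2
  refine h2.trans (le_of_eq ?_)
  congr 1
  field_simp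

/-! ### The functions `φ`, `ψ` and `μ` -/

section RealFunctions

variable {n : ℕ} {q : ℝ≥0∞} {x y : ℝ}

lemma one_le_a (hn : 2 ≤ n) : 1 ≤ a n q :=
  Real.one_le_rpow (by have : (2 : ℝ) ≤ n := by exact_mod_cast hn
                       linarith) ENNReal.toReal_nonneg

lemma one_le_b : 1 ≤ b q := Real.one_le_rpow one_le_two ENNReal.toReal_nonneg

/-- `R` is at most the smaller zero of `1 - m x + b x²` and at most `1 / (a + 1)`: this comes from
the two factorizations `m² - 4b = (a + 1 - b)² + 4ab` and
`4 (1 - m x + b x²) = (2 - (m + √Δ) x) (2 - (m - √Δ) x)` with `Δ = m² - 4b`. -/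
lemma quadratic_pos_and_linear_pos (hn : 2 ≤ n) (hx0 : 0 ≤ x) (hx : x < R n q) :
    0 < 1 - m n q * x + b q * x ^ 2 ∧ 0 < 1 - (a n q + 1) * x := by
  have ha := one_le_a (q := q) hn
  have hb := one_le_b (q := q)
  have hD : m n q ^ 2 - 4 * b q = (a n q + 1 - b q) ^ 2 + 4 * (a n q * b q) := by
    unfold m; ring
  have hD0 : 0 ≤ m n q ^ 2 - 4 * b q := by rw [hD]; positivity
  have hs2 := Real.sq_sqrt hD0
  have hs0 := Real.sqrt_nonneg (m n q ^ 2 - 4 * b q)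
  have hs1 : a n q + 1 - b q ≤ √(m n q ^ 2 - 4 * b q) := by
    refine Real.le_sqrt_of_sq_le ?_
    rw [hD]
    nlinarith
  have hm : m n q = a n q + b q + 1 := rfl
  have hlt : x * (m n q + √(m n q ^ 2 - 4 * b q)) < 2 :=
    (lt_div_iff₀ (by linarith)).1 hx
  set s := √(m n q ^ 2 - 4 * b q)
  constructor
  · have h1 : 0 < 2 - (m n q + s) * x := by linarith
    have h2 : 0 < 2 - (m n q - s) * x := by nlinarith
    nlinarith [mul_pos h1 h2]
  · nlinarith

lemma quadratic_pos (hn : 2 ≤ n) (hx0 : 0 ≤ x) (hx : x < R n q) :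
    0 < 1 - m n q * x + b q * x ^ 2 :=
  (quadratic_pos_and_linear_pos hn hx0 hx).1

lemma linear_pos (hn : 2 ≤ n) (hx0 : 0 ≤ x) (hx : x < R n q) : 0 < 1 - (a n q + 1) * x :=
  (quadratic_pos_and_linear_pos hn hx0 hx).2

lemma two_mul_lt_one (hn : 2 ≤ n) (hx0 : 0 ≤ x) (hx : x < R n q) : 2 * x < 1 := by
  nlinarith [linear_pos hn hx0 hx, one_le_a (q := q) hn]

lemma second_quadratic_pos (hn : 2 ≤ n) (hx0 : 0 ≤ x) (hx : x < R n q) :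
    0 < 1 - (a n q + 2) * x + x ^ 2 := by
  have h := quadratic_pos hn hx0 hx
  unfold m at h
  nlinarith [mul_nonneg (mul_nonneg (sub_nonneg.2 (one_le_b (q := q))) hx0)
    (by linarith [two_mul_lt_one hn hx0 hx] : 0 ≤ 1 - x)]

lemma mu_pos (hn : 2 ≤ n) (hx0 : 0 ≤ x) (hx : x < R n q) : 0 < mu n q x :=
  div_pos (by linarith [two_mul_lt_one hn hx0 hx]) (linear_pos hn hx0 hx)

lemma psi_pos (hn : 2 ≤ n) (hx0 : 0 ≤ x) (hx : x < R n q) : 0 < psi n q x :=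
  div_pos (quadratic_pos hn hx0 hx) (linear_pos hn hx0 hx)

lemma psi_eq (hn : 2 ≤ n) (hx0 : 0 ≤ x) (hx : x < R n q) :
    psi n q x = 1 - b q * x * mu n q x := by
  have h := (linear_pos hn hx0 hx).ne'
  unfold psi mu
  rw [div_eq_iff h, sub_mul, mul_assoc (b q * x), div_mul_cancel₀ _ h]
  unfold m
  ring

lemma one_sub_mul_mu_eq (hn : 2 ≤ n) (hx0 : 0 ≤ x) (hx : x < R n q) :
    1 - x * mu n q x = (1 - (a n q + 2) * x + x ^ 2) / (1 - (a n q + 1) * x) := by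
  have h := (linear_pos hn hx0 hx).ne'
  unfold mu
  rw [eq_div_iff h, sub_mul, mul_assoc, div_mul_cancel₀ _ h]
  ring

lemma one_sub_mul_mu_pos (hn : 2 ≤ n) (hx0 : 0 ≤ x) (hx : x < R n q) :
    0 < 1 - x * mu n q x := by
  rw [one_sub_mul_mu_eq hn hx0 hx]
  exact div_pos (second_quadratic_pos hn hx0 hx) (linear_pos hn hx0 hx)

lemma mu_le_mu (hn : 2 ≤ n) (hy0 : 0 ≤ y) (hyx : y ≤ x) (hx : x < R n q) :
    mu n q y ≤ mu n q x := by
  have hx0 := hy0.trans hyx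
  have h1 := linear_pos hn hx0 hx
  have h2 := linear_pos hn hy0 (hyx.trans_lt hx)
  unfold mu
  rw [div_le_div_iff₀ h2 h1]
  nlinarith [one_le_a (q := q) hn]

/-- The last factor of `φ`. -/
noncomputable def phiFactor (n : ℕ) (q : ℝ≥0∞) (x : ℝ) : ℝ :=
  (1 + 1 / ((n : ℝ) - 1) * (a n q * (x - x ^ 2) / (1 - m n q * x + b q * x ^ 2))) ^ (n - 1)

/-- `φ(x) / x³`, continued to `x = 0`. -/
noncomputable def phiCoeff (n : ℕ) (q : ℝ≥0∞) (x : ℝ) : ℝ :=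
  a n q ^ 2 / ((1 - m n q * x + b q * x ^ 2) * (1 - (a n q + 2) * x + x ^ 2)) * phiFactor n q x

/-- `ψ(x) φ(x) / x³`, continued to `x = 0`. -/
noncomputable def psiPhiCoeff (n : ℕ) (q : ℝ≥0∞) (x : ℝ) : ℝ :=
  a n q ^ 2 / ((1 - (a n q + 1) * x) * (1 - (a n q + 2) * x + x ^ 2)) * phiFactor n q x

lemma phi_eq : phi n q x = x ^ 3 * phiCoeff n q x := by
  unfold phi phiCoeff phiFactor
  ring

lemma psi_mul_phi_eq (hn : 2 ≤ n) (hx0 : 0 ≤ x) (hx : x < R n q) :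
    psi n q x * phi n q x = x ^ 3 * psiPhiCoeff n q x := by
  have h1 := (quadratic_pos hn hx0 hx).ne'
  have h2 := (linear_pos hn hx0 hx).ne'
  have h3 := (second_quadratic_pos hn hx0 hx).ne'
  rw [phi_eq]
  unfold psi phiCoeff psiPhiCoeff
  generalize 1 - m n q * x + b q * x ^ 2 = A at *
  generalize 1 - (a n q + 1) * x = B at *
  generalize 1 - (a n q + 2) * x + x ^ 2 = C at *
  field_simp

lemma quadratic_le_quadratic (hn : 2 ≤ n) (hy0 : 0 ≤ y) (hyx : y ≤ x) (hx : x < R n q) :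
    1 - m n q * x + b q * x ^ 2 ≤ 1 - m n q * y + b q * y ^ 2 := by
  have h := two_mul_lt_one hn (hy0.trans hyx) hx
  have hm : m n q = a n q + b q + 1 := rfl
  have ha := one_le_a (q := q) hn
  have hb := one_le_b (q := q)
  have h1 : 0 ≤ m n q - b q * (x + y) := by rw [hm]; nlinarith
  nlinarith [mul_nonneg h1 (sub_nonneg.2 hyx)]

lemma one_le_phiFactor_base (hn : 2 ≤ n) (hx0 : 0 ≤ x) (hx : x < R n q) :
    1 ≤ 1 + 1 / ((n : ℝ) - 1) * (a n q * (x - x ^ 2) / (1 - m n q * x + b q * x ^ 2)) := by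
  have hn1 : (2 : ℝ) ≤ n := by exact_mod_cast hn
  have h1 := quadratic_pos hn hx0 hx
  have h2 : 0 ≤ x - x ^ 2 := by nlinarith [two_mul_lt_one hn hx0 hx]
  have ha := one_le_a (q := q) hn
  have h3 : 0 ≤ 1 / ((n : ℝ) - 1) := by
    apply one_div_nonneg.2; linarith
  have := mul_nonneg h3 (div_nonneg (mul_nonneg (zero_le_one.trans ha) h2) h1.le)
  linarith

lemma phiFactor_nonneg (hn : 2 ≤ n) (hx0 : 0 ≤ x) (hx : x < R n q) : 0 ≤ phiFactor n q x :=
  pow_nonneg (zero_le_one.trans (one_le_phiFactor_base hn hx0 hx)) _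

lemma phiFactor_le_phiFactor (hn : 2 ≤ n) (hy0 : 0 ≤ y) (hyx : y ≤ x) (hx : x < R n q) :
    phiFactor n q y ≤ phiFactor n q x := by
  have hn1 : (2 : ℝ) ≤ n := by exact_mod_cast hn
  have hx0 := hy0.trans hyx
  have ha := one_le_a (q := q) hn
  have h1 := quadratic_pos hn hx0 hx
  have h2 := two_mul_lt_one hn hx0 hx
  have h3 : y - y ^ 2 ≤ x - x ^ 2 := by nlinarith
  have h4 : 0 ≤ x - x ^ 2 := by nlinarith
  have h5 : 0 ≤ 1 / ((n : ℝ) - 1) := by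
    apply one_div_nonneg.2; linarith
  refine pow_le_pow_left₀ (zero_le_one.trans (one_le_phiFactor_base hn hy0 (hyx.trans_lt hx))) ?_ _
  have h6 := div_le_div₀ (by positivity) (mul_le_mul_of_nonneg_left h3 (zero_le_one.trans ha)) h1
    (quadratic_le_quadratic hn hy0 hyx hx)
  linarith [mul_le_mul_of_nonneg_left h6 h5]

lemma second_quadratic_le (hn : 2 ≤ n) (hy0 : 0 ≤ y) (hyx : y ≤ x) (hx : x < R n q) :
    1 - (a n q + 2) * x + x ^ 2 ≤ 1 - (a n q + 2) * y + y ^ 2 := by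
  have h := two_mul_lt_one hn (hy0.trans hyx) hx
  have ha := one_le_a (q := q) hn
  nlinarith

lemma phiCoeff_nonneg (hn : 2 ≤ n) (hx0 : 0 ≤ x) (hx : x < R n q) : 0 ≤ phiCoeff n q x :=
  mul_nonneg (div_nonneg (sq_nonneg _) (mul_nonneg (quadratic_pos hn hx0 hx).le
    (second_quadratic_pos hn hx0 hx).le)) (phiFactor_nonneg hn hx0 hx)

lemma psiPhiCoeff_nonneg (hn : 2 ≤ n) (hx0 : 0 ≤ x) (hx : x < R n q) : 0 ≤ psiPhiCoeff n q x :=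
  mul_nonneg (div_nonneg (sq_nonneg _) (mul_nonneg (linear_pos hn hx0 hx).le
    (second_quadratic_pos hn hx0 hx).le)) (phiFactor_nonneg hn hx0 hx)

lemma phiCoeff_le_phiCoeff (hn : 2 ≤ n) (hy0 : 0 ≤ y) (hyx : y ≤ x) (hx : x < R n q) :
    phiCoeff n q y ≤ phiCoeff n q x := by
  have hx0 := hy0.trans hyx
  have hy := hyx.trans_lt hx
  have h1 := quadratic_pos hn hx0 hx
  have h2 := second_quadratic_pos hn hx0 hx
  refine mul_le_mul ?_ (phiFactor_le_phiFactor hn hy0 hyx hx) (phiFactor_nonneg hn hy0 hy)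
    (by positivity)
  exact div_le_div_of_nonneg_left (sq_nonneg _) (mul_pos h1 h2)
    (mul_le_mul (quadratic_le_quadratic hn hy0 hyx hx) (second_quadratic_le hn hy0 hyx hx) h2.le
      (quadratic_pos hn hy0 hy).le)

lemma psiPhiCoeff_le_psiPhiCoeff (hn : 2 ≤ n) (hy0 : 0 ≤ y) (hyx : y ≤ x) (hx : x < R n q) :
    psiPhiCoeff n q y ≤ psiPhiCoeff n q x := by
  have hx0 := hy0.trans hyx
  have hy := hyx.trans_lt hx
  have ha := one_le_a (q := q) hn
  have h1 := linear_pos hn hx0 hx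
  have h2 := second_quadratic_pos hn hx0 hx
  refine mul_le_mul ?_ (phiFactor_le_phiFactor hn hy0 hyx hx) (phiFactor_nonneg hn hy0 hy)
    (by positivity)
  exact div_le_div_of_nonneg_left (sq_nonneg _) (mul_pos h1 h2)
    (mul_le_mul (by nlinarith) (second_quadratic_le hn hy0 hyx hx) h2.le (linear_pos hn hy0 hy).le)

lemma phi_nonneg (hn : 2 ≤ n) (hx0 : 0 ≤ x) (hx : x < R n q) : 0 ≤ phi n q x := by
  rw [phi_eq]
  exact mul_nonneg (pow_nonneg hx0 3) (phiCoeff_nonneg hn hx0 hx)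

/-- `φ` is quasi-homogeneous of degree three. -/
lemma phi_le_pow_mul (hn : 2 ≤ n) {t : ℝ} (ht1 : t ≤ 1) (hx0 : 0 ≤ x) (hx : x < R n q)
    (hy0 : 0 ≤ y) (hyx : y ≤ x * t) : phi n q y ≤ t ^ 3 * phi n q x := by
  have hyx' : y ≤ x := hyx.trans (mul_le_of_le_one_right hx0 ht1)
  rw [phi_eq, phi_eq, ← mul_assoc, ← mul_pow, mul_comm t x]
  exact mul_le_mul (pow_le_pow_left₀ hy0 hyx 3) (phiCoeff_le_phiCoeff hn hy0 hyx' hx)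
    (phiCoeff_nonneg hn hy0 (hyx'.trans_lt hx)) (pow_nonneg (hy0.trans hyx) 3)

/-- `ψφ` is quasi-homogeneous of degree three, although `ψ` is decreasing. -/
lemma psi_mul_phi_le_pow_mul (hn : 2 ≤ n) {t : ℝ} (ht1 : t ≤ 1) (hx0 : 0 ≤ x) (hx : x < R n q)
    (hy0 : 0 ≤ y) (hyx : y ≤ x * t) :
    psi n q y * phi n q y ≤ t ^ 3 * (psi n q x * phi n q x) := by
  have hyx' : y ≤ x := hyx.trans (mul_le_of_le_one_right hx0 ht1)
  have hy := hyx'.trans_lt hx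
  rw [psi_mul_phi_eq hn hy0 hy, psi_mul_phi_eq hn hx0 hx, ← mul_assoc, ← mul_pow, mul_comm t x]
  exact mul_le_mul (pow_le_pow_left₀ hy0 hyx 3) (psiPhiCoeff_le_psiPhiCoeff hn hy0 hyx' hx)
    (psiPhiCoeff_nonneg hn hy0 hy) (pow_nonneg (hy0.trans hyx) 3)

lemma psi_mul_pow_phi_lt_one (hn : 2 ≤ n) (hx0 : 0 ≤ x) (hx : x < R n q) (hphi : phi n q x ≤ 1)
    {k : ℕ} (hk : k ≠ 0) : psi n q x * phi n q x ^ k < 1 := by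
  have hl := phi_nonneg hn hx0 hx
  rcases hx0.eq_or_lt with rfl | hpos
  · -- at `x = 0` one has `ψ = 1`, but `φ = 0`
    simp [phi_eq, hk]
  · have h : psi n q x < 1 := by
      rw [psi_eq hn hx0 hx]
      have := mul_pos (mul_pos (zero_lt_one.trans_le (one_le_b (q := q))) hpos) (mu_pos hn hx0 hx)
      linarith
    exact (mul_le_of_le_one_right (psi_pos hn hx0 hx).le (pow_le_one₀ hl hphi)).trans_lt h

end RealFunctions

/-! ### Weierstrass corrections and interpolation -/

section Interpolation

variable {n : ℕ} {f : ℂ[X]} {z : Fin n → ℂ}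

lemma prod_erase_sub_ne_zero (hz : Function.Injective z) (i : Fin n) :
    ∏ j ∈ Finset.univ.erase i, (z i - z j) ≠ 0 :=
  Finset.prod_ne_zero_iff.2 fun _ hj => sub_ne_zero.2 fun h => Finset.ne_of_mem_erase hj (hz h.symm)

/-- Lagrange interpolation of `f` at the nodes `z`: both sides are monic of degree `n` and agree at
the `n` nodes. -/
lemma eval_eq_prod_add_sum (hf : f.Monic) (hdeg : f.natDegree = n) (hz : Function.Injective z)
    (t : ℂ) :
    f.eval t = ∏ j, (t - z j) +
      ∑ i, W f z i * ∏ j ∈ Finset.univ.erase i, (t - z j) := by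
  set P : ℂ[X] := ∏ j, (X - C (z j)) with hP
  set Q : ℂ[X] := ∑ i, C (W f z i) * ∏ j ∈ Finset.univ.erase i, (X - C (z j)) with hQ
  have hPm : P.Monic := monic_prod_of_monic _ _ fun j _ => monic_X_sub_C _
  have hPd : P.degree = n := by simp [hP, degree_prod]
  have hfd : f.degree = n := by rw [degree_eq_natDegree hf.ne_zero, hdeg]
  have h1 : (f - P).degree < (Finset.univ : Finset (Fin n)).card := by
    rw [Finset.card_univ, Fintype.card_fin, ← hfd]
    exact degree_sub_lt_left (hfd.trans hPd.symm) hf.ne_zero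
      (hf.leadingCoeff.trans hPm.leadingCoeff.symm)
  have h2 : Q.degree < (Finset.univ : Finset (Fin n)).card := by
    refine (degree_sum_le _ _).trans_lt ?_
    refine (Finset.sup_lt_iff (WithBot.bot_lt_coe _)).2 fun i _ => ?_
    refine (degree_mul_le _ _).trans_lt ((add_le_add degree_C_le le_rfl).trans_lt ?_)
    rw [zero_add, degree_prod]
    simp only [degree_X_sub_C, Finset.sum_const, nsmul_one]
    rw [Nat.cast_lt]
    exact Finset.card_lt_card (Finset.erase_ssubset (Finset.mem_univ i))
  have h3 : f - P = Q := by
    refine eq_of_degrees_lt_of_eval_index_eq Finset.univ hz.injOn h1 h2 fun k _ => ?_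
    have hPk : P.eval (z k) = 0 := by
      rw [hP, eval_prod]
      exact Finset.prod_eq_zero (Finset.mem_univ k) (by simp)
    rw [eval_sub, hPk, sub_zero, hQ, eval_finsetSum, Finset.sum_eq_single k]
    · simp only [eval_mul, eval_C, eval_prod, eval_sub, eval_X, W]
      rw [div_mul_cancel₀ _ (prod_erase_sub_ne_zero hz k)]
    · intro i _ hik
      rw [eval_mul, eval_prod]
      rw [Finset.prod_eq_zero (Finset.mem_erase.2 ⟨hik.symm, Finset.mem_univ k⟩) (by simp),
        mul_zero]
    · simp
  have h4 := congrArg (eval t) (sub_eq_iff_eq_add'.1 h3)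
  simpa [hP, hQ, eval_prod, eval_finsetSum] using h4

/-- The interpolation formula in quotient form, with the node `z i` singled out. -/
lemma eval_eq_mul_prod_erase (hf : f.Monic) (hdeg : f.natDegree = n) (hz : Function.Injective z)
    (i : Fin n) {t : ℂ} (ht : ∀ j, j ≠ i → t ≠ z j) :
    f.eval t = (t - z i + W f z i + (t - z i) * ∑ j ∈ Finset.univ.erase i, W f z j / (t - z j)) *
      ∏ j ∈ Finset.univ.erase i, (t - z j) := by
  have key : ∀ k ∈ Finset.univ.erase i, W f z k * ∏ j ∈ Finset.univ.erase k, (t - z j) =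
      (t - z i) * (W f z k / (t - z k)) * ∏ j ∈ Finset.univ.erase i, (t - z j) := by
    intro k hk
    have hki := Finset.ne_of_mem_erase hk
    have h0 : t - z k ≠ 0 := sub_ne_zero.2 (ht k hki)
    have hik : i ∈ Finset.univ.erase k := Finset.mem_erase.2 ⟨hki.symm, Finset.mem_univ i⟩
    rw [← Finset.mul_prod_erase _ _ hik, ← Finset.mul_prod_erase _ _ hk, Finset.erase_right_comm]
    field_simp
  rw [eval_eq_prod_add_sum hf hdeg hz t, ← Finset.mul_prod_erase _ _ (Finset.mem_univ i),
    ← Finset.add_sum_erase _ _ (Finset.mem_univ i), Finset.sum_congr rfl key, ← Finset.sum_mul,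
    ← Finset.mul_sum]
  ring

end Interpolation

/-! ### One step of the iteration -/

section Distances

variable {n : ℕ} {f : ℂ[X]} {z : Fin n → ℂ}

lemma d_le {i j : Fin n} (hij : j ≠ i) : d z i ≤ ‖z i - z j‖ :=
  ciInf_le (f := fun j : {j : Fin n // j ≠ i} => ‖z i - z j‖) (Set.finite_range _).bddBelow ⟨j, hij⟩

lemma nonempty_ne (hn : 2 ≤ n) (i : Fin n) : Nonempty {j : Fin n // j ≠ i} := by
  have : Nontrivial (Fin n) := Fin.nontrivial_iff_two_le.2 hn
  obtain ⟨j, hj⟩ := exists_ne i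
  exact ⟨⟨j, hj⟩⟩

lemma exists_eq_d (hn : 2 ≤ n) (z : Fin n → ℂ) (i : Fin n) : ∃ j, j ≠ i ∧ d z i = ‖z i - z j‖ := by
  have := nonempty_ne hn i
  obtain ⟨j, hj⟩ := exists_eq_ciInf_of_finite (f := fun j : {j : Fin n // j ≠ i} => ‖z i - z j‖)
  exact ⟨j, j.2, hj.symm⟩

lemma d_pos (hn : 2 ≤ n) (hz : Function.Injective z) (i : Fin n) : 0 < d z i := by
  obtain ⟨j, hj, h⟩ := exists_eq_d hn z i
  rw [h]
  exact norm_pos_iff.2 (sub_ne_zero.2 fun h => hj (hz h.symm))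

/-- The quotient `|W_i(z)| / d_i(z)`. -/
noncomputable def ratio (f : ℂ[X]) (z : Fin n → ℂ) (i : Fin n) : ℝ := ‖W f z i‖ / d z i

lemma norm_W_div_d (hn : 2 ≤ n) (hz : Function.Injective z) (i : Fin n) :
    ‖W f z i / (d z i : ℂ)‖ = ratio f z i := by
  rw [norm_div, Complex.norm_of_nonneg (d_pos hn hz i).le, ratio]

lemma ratio_nonneg (hn : 2 ≤ n) (hz : Function.Injective z) (i : Fin n) : 0 ≤ ratio f z i :=
  div_nonneg (norm_nonneg _) (d_pos hn hz i).le

lemma norm_W_eq (hn : 2 ≤ n) (hz : Function.Injective z) (i : Fin n) :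
    ‖W f z i‖ = ratio f z i * d z i :=
  (div_mul_cancel₀ _ (d_pos hn hz i).ne').symm

lemma norm_W_le (hn : 2 ≤ n) (hz : Function.Injective z) {i j : Fin n} (hij : j ≠ i) :
    ‖W f z i‖ ≤ ratio f z i * ‖z i - z j‖ := by
  rw [norm_W_eq hn hz]
  exact mul_le_mul_of_nonneg_left (d_le hij) (ratio_nonneg hn hz i)

lemma norm_W_le' (hn : 2 ≤ n) (hz : Function.Injective z) {i j : Fin n} (hij : j ≠ i) :
    ‖W f z j‖ ≤ ratio f z j * ‖z i - z j‖ := by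
  rw [norm_sub_rev]
  exact norm_W_le hn hz hij.symm

end Distances

section Step

variable {n : ℕ} {f : ℂ[X]} {z : Fin n → ℂ} {p q : ℝ≥0∞}

lemma E_nonneg (hp : 1 ≤ p) : 0 ≤ E p f z := pnorm_nonneg hp _

lemma one_sub_E_pos (hn : 2 ≤ n) (hp : 1 ≤ p) (hx : E p f z < R n q) : 0 < 1 - E p f z := by
  have hx0 : 0 ≤ E p f z := E_nonneg hp
  linarith [two_mul_lt_one hn hx0 hx]

lemma ratio_le_E (hn : 2 ≤ n) (hp : 1 ≤ p) (hz : Function.Injective z) (i : Fin n) :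
    ratio f z i ≤ E p f z := by
  rw [← norm_W_div_d hn hz]
  exact norm_apply_le_pnorm hp (fun i => W f z i / (d z i : ℂ)) i

lemma sum_ratio_le (hn : 2 ≤ n) (hp : 1 ≤ p) (hpq : 1 / p + 1 / q = 1) (hz : Function.Injective z)
    (i : Fin n) : ∑ j ∈ Finset.univ.erase i, ratio f z j ≤ a n q * E p f z := by
  simp_rw [← norm_W_div_d hn hz]
  exact sum_erase_norm_le hn hp hpq _ i

lemma ratio_add_ratio_le (hn : 2 ≤ n) (hp : 1 ≤ p) (hpq : 1 / p + 1 / q = 1)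
    (hz : Function.Injective z) {i j : Fin n} (hij : i ≠ j) :
    ratio f z i + ratio f z j ≤ b q * E p f z := by
  simp_rw [← norm_W_div_d hn hz]
  exact norm_add_norm_le hp hpq (fun i => W f z i / (d z i : ℂ)) hij

lemma norm_sub_sub_W_ge (hn : 2 ≤ n) (hp : 1 ≤ p) (hz : Function.Injective z) {i j : Fin n}
    (hij : j ≠ i) : (1 - E p f z) * ‖z i - z j‖ ≤ ‖z i - z j - W f z i‖ := by
  have h1 := norm_W_le (f := f) hn hz hij
  have h2 := mul_le_mul_of_nonneg_right (ratio_le_E (f := f) hn hp hz i) (norm_nonneg (z i - z j))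
  have h3 := norm_sub_norm_le (z i - z j) (W f z i)
  linarith

lemma norm_sub_pos (hz : Function.Injective z) {i j : Fin n} (hij : j ≠ i) : 0 < ‖z i - z j‖ :=
  norm_pos_iff.2 (sub_ne_zero.2 fun h => hij (hz h.symm))

lemma norm_den_sub_one_le (hn : 2 ≤ n) (hp : 1 ≤ p) (hpq : 1 / p + 1 / q = 1)
    (hz : Function.Injective z) (hx : E p f z < R n q) (i : Fin n) :
    ‖den f z i - 1‖ ≤ a n q * E p f z / (1 - E p f z) := by
  have hx1 := one_sub_E_pos hn hp hx
  rw [den, add_sub_cancel_left]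
  refine (norm_sum_le _ _).trans ?_
  calc ∑ j ∈ Finset.univ.erase i, ‖W f z j / (z i - z j - W f z i)‖
      ≤ ∑ j ∈ Finset.univ.erase i, ratio f z j / (1 - E p f z) := by
        refine Finset.sum_le_sum fun j hj => ?_
        have hij := Finset.ne_of_mem_erase hj
        have hpos := norm_sub_pos hz hij
        rw [norm_div]
        calc ‖W f z j‖ / ‖z i - z j - W f z i‖
            ≤ (ratio f z j * ‖z i - z j‖) / ((1 - E p f z) * ‖z i - z j‖) :=
              div_le_div₀ (mul_nonneg (ratio_nonneg hn hz j) hpos.le) (norm_W_le' hn hz hij)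
                (mul_pos hx1 hpos) (norm_sub_sub_W_ge hn hp hz hij)
          _ = _ := mul_div_mul_right _ _ hpos.ne'
    _ = (∑ j ∈ Finset.univ.erase i, ratio f z j) / (1 - E p f z) := (Finset.sum_div _ _ _).symm
    _ ≤ _ := div_le_div_of_nonneg_right (sum_ratio_le hn hp hpq hz i) hx1.le

lemma norm_den_ge (hn : 2 ≤ n) (hp : 1 ≤ p) (hpq : 1 / p + 1 / q = 1)
    (hz : Function.Injective z) (hx : E p f z < R n q) (i : Fin n) :
    (mu n q (E p f z))⁻¹ ≤ ‖den f z i‖ := by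
  have hx1 := one_sub_E_pos hn hp hx
  have h1 := norm_den_sub_one_le hn hp hpq hz hx i
  have h2 : 1 ≤ ‖den f z i‖ + ‖den f z i - 1‖ := by
    have := norm_sub_le (den f z i) (den f z i - 1)
    rwa [sub_sub_cancel, norm_one] at this
  have h3 : (mu n q (E p f z))⁻¹ = 1 - a n q * E p f z / (1 - E p f z) := by
    rw [mu, inv_div, eq_sub_iff_add_eq, ← add_div, div_eq_one_iff_eq hx1.ne']
    ring
  linarith

lemma isDefinedAt (hn : 2 ≤ n) (hp : 1 ≤ p) (hpq : 1 / p + 1 / q = 1)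
    (hz : Function.Injective z) (hx : E p f z < R n q) : IsDefinedAt f z := by
  have hx1 := one_sub_E_pos hn hp hx
  refine ⟨hz, fun i j hij => ?_, fun i => ?_⟩
  · exact norm_pos_iff.1 ((mul_pos hx1 (norm_sub_pos hz hij)).trans_le
      (norm_sub_sub_W_ge hn hp hz hij))
  · exact norm_pos_iff.1 ((inv_pos.2 (mu_pos hn (E_nonneg hp) hx)).trans_le
      (norm_den_ge hn hp hpq hz hx i))

lemma norm_G_sub_le (hn : 2 ≤ n) (hp : 1 ≤ p) (hpq : 1 / p + 1 / q = 1)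
    (hz : Function.Injective z) (hx : E p f z < R n q) (i : Fin n) :
    ‖G f z i - z i‖ ≤ mu n q (E p f z) * ‖W f z i‖ := by
  have hmu := mu_pos hn (E_nonneg hp) hx
  have h := norm_den_ge hn hp hpq hz hx i
  have h1 : G f z i - z i = -(W f z i / den f z i) := by simp [G]
  rw [h1, norm_neg, norm_div, div_eq_inv_mul]
  exact mul_le_mul_of_nonneg_right (inv_le_of_inv_le₀ hmu h) (norm_nonneg _)

lemma psi_mul_norm_sub_le (hn : 2 ≤ n) (hp : 1 ≤ p) (hpq : 1 / p + 1 / q = 1)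
    (hz : Function.Injective z) (hx : E p f z < R n q) {i j : Fin n} (hij : j ≠ i) :
    psi n q (E p f z) * ‖z i - z j‖ ≤ ‖G f z i - G f z j‖ := by
  have hmu := mu_pos hn (E_nonneg hp) hx
  have hi := norm_G_sub_le hn hp hpq hz hx i
  have hj := norm_G_sub_le hn hp hpq hz hx j
  have h1 := mul_le_mul_of_nonneg_left (norm_W_le (f := f) hn hz hij) hmu.le
  have h2 := mul_le_mul_of_nonneg_left (norm_W_le' (f := f) hn hz hij) hmu.le
  have h3 := mul_le_mul_of_nonneg_left (mul_le_mul_of_nonneg_right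
    (ratio_add_ratio_le (f := f) hn hp hpq hz hij.symm) (norm_nonneg (z i - z j))) hmu.le
  have h4 : ‖z i - z j‖ ≤ ‖G f z i - G f z j‖ + ‖G f z i - z i‖ + ‖G f z j - z j‖ := by
    have e : z i - z j = (G f z i - G f z j) - (G f z i - z i) + (G f z j - z j) := by ring
    calc ‖z i - z j‖ = ‖(G f z i - G f z j) - (G f z i - z i) + (G f z j - z j)‖ := by rw [← e]
      _ ≤ _ := (norm_add_le _ _).trans (by gcongr; exact norm_sub_le _ _)
  rw [psi_eq hn (E_nonneg hp) hx]
  linarith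

lemma injective_G (hn : 2 ≤ n) (hp : 1 ≤ p) (hpq : 1 / p + 1 / q = 1)
    (hz : Function.Injective z) (hx : E p f z < R n q) : Function.Injective (G f z) := by
  intro i j h
  by_contra hij
  have h1 := psi_mul_norm_sub_le hn hp hpq hz hx (Ne.symm hij)
  rw [h, sub_self, norm_zero] at h1
  exact absurd h1 (not_le.2 (mul_pos (psi_pos hn (E_nonneg hp) hx) (norm_sub_pos hz (Ne.symm hij))))

lemma psi_mul_d_le (hn : 2 ≤ n) (hp : 1 ≤ p) (hpq : 1 / p + 1 / q = 1)
    (hz : Function.Injective z) (hx : E p f z < R n q) (i : Fin n) :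
    psi n q (E p f z) * d z i ≤ d (G f z) i := by
  obtain ⟨j, hj, h⟩ := exists_eq_d hn (G f z) i
  rw [h]
  exact (mul_le_mul_of_nonneg_left (d_le hj) (psi_pos hn (E_nonneg hp) hx).le).trans
    (psi_mul_norm_sub_le hn hp hpq hz hx hj)

lemma norm_G_sub_node_ge (hn : 2 ≤ n) (hp : 1 ≤ p) (hpq : 1 / p + 1 / q = 1)
    (hz : Function.Injective z) (hx : E p f z < R n q) {i j : Fin n} (hij : j ≠ i) :
    (1 - E p f z * mu n q (E p f z)) * ‖z i - z j‖ ≤ ‖G f z i - z j‖ := by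
  have hmu := mu_pos hn (E_nonneg hp) hx
  have hi := norm_G_sub_le hn hp hpq hz hx i
  have h1 := mul_le_mul_of_nonneg_left (norm_W_le (f := f) hn hz hij) hmu.le
  have h2 := mul_le_mul_of_nonneg_left (mul_le_mul_of_nonneg_right
    (ratio_le_E (f := f) hn hp hz i) (norm_nonneg (z i - z j))) hmu.le
  have h3 : ‖z i - z j‖ ≤ ‖G f z i - z j‖ + ‖G f z i - z i‖ := by
    have := norm_sub_le (G f z i - z j) (G f z i - z i)
    rwa [sub_sub_sub_cancel_left] at this
  linarith

/-- The Weierstrass correction after one step. Nourein's correction is chosen so that the factor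
`1 + ∑ W_k / (t - z_k)` of `f(t)`, taken at `t = G_i(z)`, becomes a product of small quantities. -/
lemma W_G_eq (hf : f.Monic) (hdeg : f.natDegree = n) (hz : IsDefinedAt f z) (i : Fin n)
    (hG : ∀ j, j ≠ i → G f z i ≠ z j) :
    W f (G f z) i = (G f z i - z i) ^ 2 * (den f z i - 1) *
      (∑ j ∈ Finset.univ.erase i, W f z j / ((G f z i - z j) * (z i - z j - W f z i))) *
      ∏ j ∈ Finset.univ.erase i, (G f z i - z j) / (G f z i - G f z j) := by
  obtain ⟨hinj, hne, hden⟩ := hz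
  have hW : W f z i = -((G f z i - z i) * den f z i) := by
    have h0 := hden i
    simp only [G]
    field_simp
    ring
  have hsum : (∑ j ∈ Finset.univ.erase i, W f z j / (G f z i - z j)) - (den f z i - 1) =
      (G f z i - z i) * (den f z i - 1) *
        ∑ j ∈ Finset.univ.erase i, W f z j / ((G f z i - z j) * (z i - z j - W f z i)) := by
    have h : den f z i - 1 = ∑ j ∈ Finset.univ.erase i, W f z j / (z i - z j - W f z i) := by
      rw [den, add_sub_cancel_left]
    conv_lhs => rw [h]
    rw [← Finset.sum_sub_distrib, Finset.mul_sum]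
    refine Finset.sum_congr rfl fun j hj => ?_
    have hij := Finset.ne_of_mem_erase hj
    have h1 : G f z i - z j ≠ 0 := sub_ne_zero.2 (hG j hij)
    have h2 := hne i j hij
    have h3 : (G f z i - z i) * (den f z i - 1) = z i - z j - W f z i - (G f z i - z j) := by
      rw [hW]; ring
    rw [h3]
    field_simp
  rw [W, eval_eq_mul_prod_erase hf hdeg hinj i hG, mul_div_assoc, ← Finset.prod_div_distrib]
  congr 1
  rw [sub_eq_iff_eq_add] at hsum
  rw [hsum]
  linear_combination hW

/-- One step multiplies the modulus of each Weierstrass correction by at most `ψ φ`. -/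
lemma norm_W_G_le (hn : 2 ≤ n) (hf : f.Monic) (hdeg : f.natDegree = n) (hp : 1 ≤ p)
    (hpq : 1 / p + 1 / q = 1) (hz : Function.Injective z) (hx : E p f z < R n q) (i : Fin n) :
    ‖W f (G f z) i‖ ≤ psi n q (E p f z) * phi n q (E p f z) * ‖W f z i‖ := by
  have hx0 : 0 ≤ E p f z := E_nonneg hp
  have hGi := norm_G_sub_le hn hp hpq hz hx i
  have hS := norm_den_sub_one_le hn hp hpq hz hx i
  have hnode : ∀ j, j ≠ i → _ := fun j hij => norm_G_sub_node_ge hn hp hpq hz hx hij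
  have hsep : ∀ j, j ≠ i → _ := fun j hij => psi_mul_norm_sub_le hn hp hpq hz hx hij
  have hGj := norm_G_sub_le hn hp hpq hz hx
  have hW : ∀ j, j ≠ i → _ := fun j hij => norm_sub_sub_W_ge (f := f) hn hp hz hij
  have hsum := sum_ratio_le (f := f) hn hp hpq hz i
  have hri := ratio_le_E (f := f) hn hp hz i
  have hmu := mu_pos hn hx0 hx
  have hpsi := psi_pos hn hx0 hx
  have hc := one_sub_mul_mu_pos hn hx0 hx
  have hx1 : 0 < 1 - E p f z := by linarith [two_mul_lt_one hn hx0 hx]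
  have ha := one_le_a (q := q) hn
  have hd := d_pos hn hz i
  have hr0 := ratio_nonneg (f := f) hn hz
  set x := E p f z with hxdef
  have hne : ∀ j, j ≠ i → G f z i ≠ z j := fun j hij => sub_ne_zero.1
    (norm_pos_iff.1 ((mul_pos hc (norm_sub_pos hz hij)).trans_le (hnode j hij)))
  have hT : ‖∑ j ∈ Finset.univ.erase i, W f z j / ((G f z i - z j) * (z i - z j - W f z i))‖ ≤
      a n q * x / ((1 - x * mu n q x) * (1 - x) * d z i) := by
    refine (norm_sum_le _ _).trans ?_
    calc _ ≤ ∑ j ∈ Finset.univ.erase i, ratio f z j / ((1 - x * mu n q x) * (1 - x) * d z i) := by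
          refine Finset.sum_le_sum fun j hj => ?_
          have hij := Finset.ne_of_mem_erase hj
          have hpos := norm_sub_pos hz hij
          rw [norm_div, norm_mul]
          calc ‖W f z j‖ / (‖G f z i - z j‖ * ‖z i - z j - W f z i‖)
              ≤ (ratio f z j * ‖z i - z j‖) /
                  ((1 - x * mu n q x) * ‖z i - z j‖ * ((1 - x) * ‖z i - z j‖)) :=
                div_le_div₀ (mul_nonneg (hr0 j) hpos.le) (norm_W_le' hn hz hij) (by positivity)
                  (mul_le_mul (hnode j hij) (hW j hij) (by positivity) (norm_nonneg _))
            _ = ratio f z j / ((1 - x * mu n q x) * (1 - x) * ‖z i - z j‖) := by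
                generalize 1 - x * mu n q x = A at *
                generalize 1 - x = B at *
                field_simp
            -- one factor `|z i - z j|` is cancelled by `d z j`, the other one is at least `d z i`
            _ ≤ _ := by
                refine div_le_div_of_nonneg_left (hr0 j) (by positivity) ?_
                exact mul_le_mul_of_nonneg_left (d_le hij) (by positivity)
      _ = (∑ j ∈ Finset.univ.erase i, ratio f z j) / ((1 - x * mu n q x) * (1 - x) * d z i) :=
          (Finset.sum_div _ _ _).symm
      _ ≤ _ := div_le_div_of_nonneg_right hsum (by positivity)
  have hP : ‖∏ j ∈ Finset.univ.erase i, (G f z i - z j) / (G f z i - G f z j)‖ ≤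
      phiFactor n q x := by
    rw [norm_prod]
    have hcard : (Finset.univ.erase i).card = n - 1 := by
      rw [Finset.card_erase_of_mem (Finset.mem_univ i), Finset.card_univ, Fintype.card_fin]
    have hcard' : ((Finset.univ.erase i).card : ℝ) = (n : ℝ) - 1 := by
      rw [hcard, Nat.cast_sub (by omega), Nat.cast_one]
    have hne' : (Finset.univ.erase i).Nonempty := Finset.card_pos.1 (by omega)
    -- each factor is `1 + (G_j - z_j) / (G_i - G_j)`
    calc _ ≤ ∏ j ∈ Finset.univ.erase i, (1 + mu n q x / psi n q x * ratio f z j) := by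
          refine Finset.prod_le_prod (fun _ _ => norm_nonneg _) fun j hj => ?_
          have hij := Finset.ne_of_mem_erase hj
          have hpos := norm_sub_pos hz hij
          have hs : 0 < ‖G f z i - G f z j‖ := (mul_pos hpsi hpos).trans_le (hsep j hij)
          rw [norm_div, div_le_iff₀ hs]
          have h1 : ‖G f z i - z j‖ ≤ ‖G f z i - G f z j‖ + ‖G f z j - z j‖ :=
            norm_sub_le_norm_sub_add_norm_sub _ _ _
          have h2 : ‖G f z j - z j‖ ≤ mu n q x * (ratio f z j * ‖z i - z j‖) :=
            (hGj j).trans (mul_le_mul_of_nonneg_left (norm_W_le' hn hz hij) hmu.le)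
          have h3 : mu n q x * (ratio f z j * ‖z i - z j‖) ≤
              mu n q x / psi n q x * ratio f z j * ‖G f z i - G f z j‖ := by
            calc _ = mu n q x / psi n q x * ratio f z j * (psi n q x * ‖z i - z j‖) := by
                  field_simp
              _ ≤ _ := mul_le_mul_of_nonneg_left (hsep j hij)
                  (mul_nonneg (div_pos hmu hpsi).le (hr0 j))
          linarith
      _ ≤ _ := prod_one_add_le _ hne' _ fun j _ => mul_nonneg (div_pos hmu hpsi).le (hr0 j)
      _ ≤ phiFactor n q x := by
          have hn1 : (0 : ℝ) ≤ 1 / ((n : ℝ) - 1) := by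
            rw [← hcard']; positivity
          have hq : mu n q x / psi n q x * (a n q * x) =
              a n q * (x - x ^ 2) / (1 - m n q * x + b q * x ^ 2) := by
            have hl := (linear_pos hn hx0 hx).ne'
            have hD := (quadratic_pos hn hx0 hx).ne'
            rw [mu, psi, div_div_div_cancel_right₀ hl]
            ring
          rw [hcard', hcard, phiFactor, ← hq, ← Finset.mul_sum]
          have h0 := Finset.sum_nonneg fun j (_ : j ∈ Finset.univ.erase i) => hr0 j
          have h1 := mul_le_mul_of_nonneg_left hsum (div_pos hmu hpsi).le
          gcongr
  rw [W_G_eq hf hdeg (isDefinedAt hn hp hpq hz hx) i hne, norm_mul, norm_mul, norm_mul, norm_pow]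
  have hxr : ‖W f z i‖ / d z i ≤ x := hri
  calc _ ≤ (mu n q x * ‖W f z i‖) ^ 2 * (a n q * x / (1 - x)) *
        (a n q * x / ((1 - x * mu n q x) * (1 - x) * d z i)) * phiFactor n q x := by
        gcongr
    _ = mu n q x ^ 2 * (a n q * x) ^ 2 / ((1 - x) ^ 2 * (1 - x * mu n q x)) * phiFactor n q x *
        ‖W f z i‖ * (‖W f z i‖ / d z i) := by
        generalize 1 - x * mu n q x = A at *
        generalize 1 - x = B at *
        field_simp
    _ ≤ mu n q x ^ 2 * (a n q * x) ^ 2 / ((1 - x) ^ 2 * (1 - x * mu n q x)) * phiFactor n q x *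
        ‖W f z i‖ * x := by
        have := phiFactor_nonneg (q := q) hn hx0 hx
        gcongr
    _ = _ := by
        rw [psi_mul_phi_eq hn hx0 hx, one_sub_mul_mu_eq hn hx0 hx, mu, psiPhiCoeff]
        have h1 := (linear_pos hn hx0 hx).ne'
        have h2 := (second_quadratic_pos hn hx0 hx).ne'
        generalize 1 - (a n q + 1) * x = A at *
        generalize 1 - (a n q + 2) * x + x ^ 2 = C at *
        generalize 1 - x = B at *
        field_simp

lemma E_G_le (hn : 2 ≤ n) (hf : f.Monic) (hdeg : f.natDegree = n) (hp : 1 ≤ p)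
    (hpq : 1 / p + 1 / q = 1) (hz : Function.Injective z) (hx : E p f z < R n q) :
    E p f (G f z) ≤ phi n q (E p f z) * E p f z := by
  have hphi := phi_nonneg hn (E_nonneg hp) hx
  have hpsi := psi_pos hn (E_nonneg hp) hx
  refine pnorm_le_mul hp hphi fun i => ?_
  have hd := d_pos hn hz i
  rw [norm_W_div_d hn hz, norm_W_div_d hn (injective_G hn hp hpq hz hx), ratio, ratio]
  calc ‖W f (G f z) i‖ / d (G f z) i
      ≤ (psi n q (E p f z) * phi n q (E p f z) * ‖W f z i‖) / (psi n q (E p f z) * d z i) :=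
        div_le_div₀ (by positivity) (norm_W_G_le hn hf hdeg hp hpq hz hx i) (by positivity)
          (psi_mul_d_le hn hp hpq hz hx i)
    _ = _ := by field_simp

end Step

/-! ### The iterates of an admissible starting point -/

section Exponents

lemma three_mul_pow_sub_one_div (k : ℕ) : 3 * ((4 ^ k - 1) / 3) + 1 = 4 ^ k := by
  have h : 4 ^ k % 3 = 1 := by simp [Nat.pow_mod]
  generalize 4 ^ k = N at *
  omega

lemma pow_succ_sub_one_div (k : ℕ) : (4 ^ (k + 1) - 1) / 3 = (4 ^ k - 1) / 3 + 4 ^ k := by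
  have h1 := three_mul_pow_sub_one_div k
  have h2 := three_mul_pow_sub_one_div (k + 1)
  rw [pow_succ] at h2 ⊢
  omega

lemma add_pow_mul_le (k j : ℕ) : (4 ^ k - 1) / 3 + 4 ^ k * j ≤ (4 ^ (k + j) - 1) / 3 := by
  induction j with
  | zero => simp
  | succ j ih =>
    rw [← add_assoc k j 1, pow_succ_sub_one_div, mul_add, mul_one]
    have : 4 ^ k ≤ 4 ^ (k + j) := Nat.pow_le_pow_right (by norm_num) (Nat.le_add_right _ _)
    omega

end Exponents

/-- The conditions imposed on a starting point; they are inherited by all iterates. -/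
structure IsAdmissible {n : ℕ} (p q : ℝ≥0∞) (f : ℂ[X]) (z : Fin n → ℂ) : Prop where
  injective : Function.Injective z
  E_lt : E p f z < R n q
  phi_le : phi n q (E p f z) ≤ 1

section Iterates

variable {n : ℕ} {f : ℂ[X]} {z : Fin n → ℂ} {p q : ℝ≥0∞}

lemma isAdmissible_G (hn : 2 ≤ n) (hf : f.Monic) (hdeg : f.natDegree = n) (hp : 1 ≤ p)
    (hpq : 1 / p + 1 / q = 1) (hz : IsAdmissible p q f z) : IsAdmissible p q f (G f z) := by
  have hx0 : 0 ≤ E p f z := E_nonneg hp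
  have h := E_G_le hn hf hdeg hp hpq hz.injective hz.E_lt
  have h1 : E p f (G f z) ≤ E p f z := h.trans (mul_le_of_le_one_left hx0 hz.phi_le)
  refine ⟨injective_G hn hp hpq hz.injective hz.E_lt, h1.trans_lt hz.E_lt, ?_⟩
  have h2 := phi_le_pow_mul hn le_rfl hx0 hz.E_lt (E_nonneg hp (f := f) (z := G f z))
    (by rwa [mul_one])
  rw [one_pow, one_mul] at h2
  exact h2.trans hz.phi_le

lemma isAdmissible_iter (hn : 2 ≤ n) (hf : f.Monic) (hdeg : f.natDegree = n) (hp : 1 ≤ p)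
    (hpq : 1 / p + 1 / q = 1) (hz : IsAdmissible p q f z) (k : ℕ) :
    IsAdmissible p q f (iter f z k) := by
  induction k with
  | zero => exact hz
  | succ k ih => exact isAdmissible_G hn hf hdeg hp hpq ih

lemma iter_add (f : ℂ[X]) (z : Fin n → ℂ) (k j : ℕ) :
    iter f z (k + j) = iter f (iter f z k) j := by
  induction j with
  | zero => rfl
  | succ j ih => rw [← add_assoc, iter, iter, ih]

lemma E_iter_le (hn : 2 ≤ n) (hf : f.Monic) (hdeg : f.natDegree = n) (hp : 1 ≤ p)
    (hpq : 1 / p + 1 / q = 1) (hz : IsAdmissible p q f z) (k : ℕ) :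
    E p f (iter f z k) ≤ E p f z * phi n q (E p f z) ^ ((4 ^ k - 1) / 3) := by
  have hx0 : 0 ≤ E p f z := E_nonneg hp
  have hl0 := phi_nonneg hn hx0 hz.E_lt
  induction k with
  | zero => simp [iter]
  | succ k ih =>
    have hk := isAdmissible_iter hn hf hdeg hp hpq hz k
    have h1 := phi_le_pow_mul hn (pow_le_one₀ hl0 hz.phi_le) hx0 hz.E_lt (E_nonneg hp) ih
    rw [← pow_mul, ← pow_succ, mul_comm _ 3, three_mul_pow_sub_one_div] at h1
    calc E p f (iter f z (k + 1))
        ≤ phi n q (E p f (iter f z k)) * E p f (iter f z k) :=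
          E_G_le hn hf hdeg hp hpq hk.injective hk.E_lt
      _ ≤ phi n q (E p f z) ^ 4 ^ k * (E p f z * phi n q (E p f z) ^ ((4 ^ k - 1) / 3)) :=
          mul_le_mul h1 ih (E_nonneg hp) (pow_nonneg hl0 _)
      _ = _ := by rw [pow_succ_sub_one_div, pow_add]; ring

lemma E_iter_le_E (hn : 2 ≤ n) (hf : f.Monic) (hdeg : f.natDegree = n) (hp : 1 ≤ p)
    (hpq : 1 / p + 1 / q = 1) (hz : IsAdmissible p q f z) (k : ℕ) :
    E p f (iter f z k) ≤ E p f z :=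
  (E_iter_le hn hf hdeg hp hpq hz k).trans (mul_le_of_le_one_right (E_nonneg hp)
    (pow_le_one₀ (phi_nonneg hn (E_nonneg hp) hz.E_lt) hz.phi_le))

lemma norm_W_iter_le (hn : 2 ≤ n) (hf : f.Monic) (hdeg : f.natDegree = n) (hp : 1 ≤ p)
    (hpq : 1 / p + 1 / q = 1) (hz : IsAdmissible p q f z) (k : ℕ) (i : Fin n) :
    ‖W f (iter f z k) i‖ ≤
      psi n q (E p f z) ^ k * phi n q (E p f z) ^ ((4 ^ k - 1) / 3) * ‖W f z i‖ := by
  have hx0 : 0 ≤ E p f z := E_nonneg hp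
  have hl0 := phi_nonneg hn hx0 hz.E_lt
  have ht0 := psi_pos hn hx0 hz.E_lt
  induction k with
  | zero => simp [iter]
  | succ k ih =>
    have hk := isAdmissible_iter hn hf hdeg hp hpq hz k
    have h1 := psi_mul_phi_le_pow_mul hn (pow_le_one₀ hl0 hz.phi_le) hx0 hz.E_lt (E_nonneg hp)
      (E_iter_le hn hf hdeg hp hpq hz k)
    rw [mul_left_comm, ← pow_mul, ← pow_succ, mul_comm _ 3, three_mul_pow_sub_one_div] at h1
    calc ‖W f (iter f z (k + 1)) i‖
        ≤ psi n q (E p f (iter f z k)) * phi n q (E p f (iter f z k)) * ‖W f (iter f z k) i‖ :=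
          norm_W_G_le hn hf hdeg hp hpq hk.injective hk.E_lt i
      _ ≤ psi n q (E p f z) * phi n q (E p f z) ^ 4 ^ k *
          (psi n q (E p f z) ^ k * phi n q (E p f z) ^ ((4 ^ k - 1) / 3) * ‖W f z i‖) :=
          mul_le_mul h1 ih (norm_nonneg _) (by positivity)
      _ = _ := by rw [pow_succ_sub_one_div, pow_add, pow_succ]; ring

/-- From the `k`-th iterate on, the steps of each component are dominated by a geometric series
with quotient `θ λ^(4^k)`. -/
lemma dist_iter_le (hn : 2 ≤ n) (hf : f.Monic) (hdeg : f.natDegree = n) (hp : 1 ≤ p)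
    (hpq : 1 / p + 1 / q = 1) (hz : IsAdmissible p q f z) (k j : ℕ) (i : Fin n) :
    dist (iter f z (k + j) i) (iter f z (k + (j + 1)) i) ≤
      mu n q (E p f z * phi n q (E p f z) ^ ((4 ^ k - 1) / 3)) *
        (psi n q (E p f z) ^ k * phi n q (E p f z) ^ ((4 ^ k - 1) / 3)) * ‖W f z i‖ *
        (psi n q (E p f z) * phi n q (E p f z) ^ 4 ^ k) ^ j := by
  have hx0 : 0 ≤ E p f z := E_nonneg hp
  have hl0 := phi_nonneg hn hx0 hz.E_lt
  have ht0 := psi_pos hn hx0 hz.E_lt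
  have hk := isAdmissible_iter hn hf hdeg hp hpq hz (k + j)
  have hle : E p f z * phi n q (E p f z) ^ ((4 ^ k - 1) / 3) ≤ E p f z :=
    mul_le_of_le_one_right hx0 (pow_le_one₀ hl0 hz.phi_le)
  have hexp : (4 ^ k - 1) / 3 ≤ (4 ^ (k + j) - 1) / 3 :=
    (Nat.le_add_right _ _).trans (add_pow_mul_le k j)
  have hmu : mu n q (E p f (iter f z (k + j))) ≤
      mu n q (E p f z * phi n q (E p f z) ^ ((4 ^ k - 1) / 3)) :=
    mu_le_mu hn (E_nonneg hp) ((E_iter_le hn hf hdeg hp hpq hz (k + j)).trans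
      (mul_le_mul_of_nonneg_left (pow_le_pow_of_le_one hl0 hz.phi_le hexp) hx0))
      (hle.trans_lt hz.E_lt)
  have hmu0 := (mu_pos hn (E_nonneg hp) hk.E_lt).le
  have hW : ‖W f (iter f z (k + j)) i‖ ≤
      psi n q (E p f z) ^ (k + j) * phi n q (E p f z) ^ ((4 ^ k - 1) / 3 + 4 ^ k * j) *
        ‖W f z i‖ := by
    refine (norm_W_iter_le hn hf hdeg hp hpq hz (k + j) i).trans ?_
    have := pow_le_pow_of_le_one hl0 hz.phi_le (add_pow_mul_le k j)
    gcongr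
  rw [dist_eq_norm, norm_sub_rev]
  calc ‖iter f z (k + (j + 1)) i - iter f z (k + j) i‖
      ≤ mu n q (E p f (iter f z (k + j))) * ‖W f (iter f z (k + j)) i‖ :=
        norm_G_sub_le hn hp hpq hk.injective hk.E_lt i
    _ ≤ _ := mul_le_mul hmu hW (norm_nonneg _) (hmu0.trans hmu)
    _ = _ := by rw [pow_add, pow_add, mul_pow, ← pow_mul]; ring

/-- The a priori estimate for each component; for `k = 0` it is the a posteriori estimate. -/
lemma norm_iter_sub_le (hn : 2 ≤ n) (hf : f.Monic) (hdeg : f.natDegree = n) (hp : 1 ≤ p)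
    (hpq : 1 / p + 1 / q = 1) (hz : IsAdmissible p q f z) {ξ : Fin n → ℂ}
    (hξ : Tendsto (iter f z) atTop (𝓝 ξ)) (k : ℕ) (i : Fin n) :
    ‖iter f z k i - ξ i‖ ≤
      mu n q (E p f z * phi n q (E p f z) ^ ((4 ^ k - 1) / 3)) *
        (psi n q (E p f z) ^ k * phi n q (E p f z) ^ ((4 ^ k - 1) / 3) /
          (1 - psi n q (E p f z) * phi n q (E p f z) ^ 4 ^ k)) * ‖W f z i‖ := by
  have hr := psi_mul_pow_phi_lt_one hn (E_nonneg hp) hz.E_lt hz.phi_le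
    (pow_ne_zero k (four_ne_zero (α := ℕ)))
  have hlim : Tendsto (fun j => iter f z (k + j) i) atTop (𝓝 (ξ i)) := by
    have := (tendsto_pi_nhds.1 hξ i).comp (tendsto_add_atTop_nat k)
    simpa [Function.comp_def, add_comm] using this
  have h := dist_le_of_le_geometric_of_tendsto₀ _ _ hr
    (fun j => dist_iter_le hn hf hdeg hp hpq hz k j i) hlim
  rw [add_zero, dist_eq_norm] at h
  exact h.trans (le_of_eq (by ring))

/-- The a posteriori estimate for each component of the starting point. -/
lemma norm_sub_lim_le (hn : 2 ≤ n) (hf : f.Monic) (hdeg : f.natDegree = n) (hp : 1 ≤ p)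
    (hpq : 1 / p + 1 / q = 1) (hz : IsAdmissible p q f z) {ξ : Fin n → ℂ}
    (hξ : Tendsto (iter f z) atTop (𝓝 ξ)) (i : Fin n) :
    ‖z i - ξ i‖ ≤ mu n q (E p f z) / (1 - psi n q (E p f z) * phi n q (E p f z)) * ‖W f z i‖ := by
  have h := norm_iter_sub_le hn hf hdeg hp hpq hz hξ 0 i
  simp only [pow_zero, Nat.sub_self, Nat.zero_div, mul_one, pow_one, iter] at h
  exact h.trans (le_of_eq (by ring))

lemma exists_tendsto_iter (hn : 2 ≤ n) (hf : f.Monic) (hdeg : f.natDegree = n) (hp : 1 ≤ p)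
    (hpq : 1 / p + 1 / q = 1) (hz : IsAdmissible p q f z) :
    ∃ ξ, Tendsto (iter f z) atTop (𝓝 ξ) := by
  have hr := psi_mul_pow_phi_lt_one hn (E_nonneg hp) hz.E_lt hz.phi_le
    (pow_ne_zero 0 (four_ne_zero (α := ℕ)))
  have h : ∀ i, ∃ c, Tendsto (fun k => iter f z k i) atTop (𝓝 c) := fun i =>
    cauchySeq_tendsto_of_complete (cauchySeq_of_le_geometric _ _ hr fun j => by
      simpa only [zero_add] using dist_iter_le hn hf hdeg hp hpq hz 0 j i)
  choose ξ hξ using h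
  exact ⟨ξ, tendsto_pi_nhds.2 hξ⟩

lemma tendsto_W_iter (hn : 2 ≤ n) (hf : f.Monic) (hdeg : f.natDegree = n) (hp : 1 ≤ p)
    (hpq : 1 / p + 1 / q = 1) (hz : IsAdmissible p q f z) (i : Fin n) :
    Tendsto (fun k => W f (iter f z k) i) atTop (𝓝 0) := by
  have hx0 : 0 ≤ E p f z := E_nonneg hp
  have hl0 := phi_nonneg hn hx0 hz.E_lt
  have ht0 := psi_pos hn hx0 hz.E_lt
  have hr := psi_mul_pow_phi_lt_one hn hx0 hz.E_lt hz.phi_le one_ne_zero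
  rw [pow_one] at hr
  have hgeom := (tendsto_pow_atTop_nhds_zero_of_lt_one (mul_nonneg ht0.le hl0) hr).mul_const
    ‖W f z i‖
  rw [zero_mul] at hgeom
  refine squeeze_zero_norm (fun k => ?_) hgeom
  refine (norm_W_iter_le hn hf hdeg hp hpq hz k i).trans ?_
  have hk : k ≤ (4 ^ k - 1) / 3 := by simpa using add_pow_mul_le 0 k
  have := pow_le_pow_of_le_one hl0 hz.phi_le hk
  rw [mul_pow]
  gcongr

/-- The limit is a root-vector: let `k → ∞` in the interpolation formula. -/
lemma eq_prod_of_tendsto (hn : 2 ≤ n) (hf : f.Monic) (hdeg : f.natDegree = n) (hp : 1 ≤ p)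
    (hpq : 1 / p + 1 / q = 1) (hz : IsAdmissible p q f z) {ξ : Fin n → ℂ}
    (hξ : Tendsto (iter f z) atTop (𝓝 ξ)) : f = ∏ j, (X - C (ξ j)) := by
  have hlim := tendsto_pi_nhds.1 hξ
  refine Polynomial.funext fun t => ?_
  have h : Tendsto (fun k => ∏ j, (t - iter f z k j) +
      ∑ i, W f (iter f z k) i * ∏ j ∈ Finset.univ.erase i, (t - iter f z k j)) atTop
      (𝓝 (∏ j, (t - ξ j) + ∑ i, 0 * ∏ j ∈ Finset.univ.erase i, (t - ξ j))) :=
    (tendsto_finsetProd _ fun j _ => (hlim j).const_sub t).add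
      (tendsto_finsetSum _ fun i _ => (tendsto_W_iter hn hf hdeg hp hpq hz i).mul
        (tendsto_finsetProd _ fun j _ => (hlim j).const_sub t))
  have hconst : (fun k => ∏ j, (t - iter f z k j) +
      ∑ i, W f (iter f z k) i * ∏ j ∈ Finset.univ.erase i, (t - iter f z k j)) =
      fun _ => f.eval t := funext fun k =>
    (eval_eq_prod_add_sum hf hdeg (isAdmissible_iter hn hf hdeg hp hpq hz k).injective t).symm
  rw [hconst] at h
  simpa [eval_prod] using tendsto_nhds_unique tendsto_const_nhds h

lemma isRootVector_of_tendsto (hn : 2 ≤ n) (hf : f.Monic) (hdeg : f.natDegree = n) (hp : 1 ≤ p)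
    (hpq : 1 / p + 1 / q = 1) (hz : IsAdmissible p q f z) {ξ : Fin n → ℂ}
    (hξ : Tendsto (iter f z) atTop (𝓝 ξ)) : IsRootVector f ξ := by
  rw [IsRootVector, eq_prod_of_tendsto hn hf hdeg hp hpq hz hξ]
  have := roots_multiset_prod_X_sub_C (Finset.univ.val.map ξ)
  rwa [Multiset.map_map] at this

/-! ### Convergence of order four -/

/-- If `φ(E(z)) < 1`, then the zeros of `f` are simple: the balls around the `z i` that contain the
components of the limit are disjoint. -/
lemma injective_of_tendsto (hn : 2 ≤ n) (hf : f.Monic) (hdeg : f.natDegree = n) (hp : 1 ≤ p)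
    (hpq : 1 / p + 1 / q = 1) (hz : IsAdmissible p q f z) (hphi : phi n q (E p f z) < 1)
    {ξ : Fin n → ℂ} (hξ : Tendsto (iter f z) atTop (𝓝 ξ)) : Function.Injective ξ := by
  intro i j hij
  by_contra hne
  have hne' : j ≠ i := Ne.symm hne
  have hx0 : 0 ≤ E p f z := E_nonneg hp
  have hpos := norm_sub_pos hz.injective hne'
  have ht0 := psi_pos hn hx0 hz.E_lt
  have ht := psi_eq hn hx0 hz.E_lt
  have hmu := mu_pos hn hx0 hz.E_lt
  have hr := psi_mul_pow_phi_lt_one hn hx0 hz.E_lt hz.phi_le one_ne_zero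
  rw [pow_one] at hr
  have hi := norm_sub_lim_le hn hf hdeg hp hpq hz hξ i
  have hj := norm_sub_lim_le hn hf hdeg hp hpq hz hξ j
  have hb := ratio_add_ratio_le (f := f) hn hp hpq hz.injective hne
  have hWi := norm_W_le (f := f) hn hz.injective hne'
  have hWj := norm_W_le' (f := f) hn hz.injective hne'
  have htri : ‖z i - z j‖ ≤ ‖z i - ξ i‖ + ‖z j - ξ j‖ := by
    have := norm_sub_le (z i - ξ i) (z j - ξ j)
    rw [← hij, sub_sub_sub_cancel_right] at this
    rwa [← hij]
  set M := mu n q (E p f z) / (1 - psi n q (E p f z) * phi n q (E p f z)) with hM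
  have hM0 : 0 < M := div_pos hmu (by linarith)
  have h1 : ‖z i - z j‖ ≤ M * (b q * E p f z) * ‖z i - z j‖ := by
    calc ‖z i - z j‖ ≤ M * ‖W f z i‖ + M * ‖W f z j‖ := by linarith
      _ ≤ M * (ratio f z i * ‖z i - z j‖) + M * (ratio f z j * ‖z i - z j‖) := by gcongr
      _ = M * (ratio f z i + ratio f z j) * ‖z i - z j‖ := by ring
      _ ≤ _ := by gcongr
  have h2 : 1 ≤ M * (b q * E p f z) := by
    by_contra h
    nlinarith
  -- `b x μ = 1 - θ < 1 - θ λ`, hence `M b x < 1`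
  rw [hM, div_mul_eq_mul_div, le_div_iff₀ (by linarith)] at h2
  nlinarith

lemma exists_norm_le_of_tendsto {ι : Type*} [Fintype ι] {u : ℕ → ι → ℂ} {l : ι → ℂ}
    (h : ∀ i, Tendsto (fun k => u k i) atTop (𝓝 (l i))) : ∃ B, 0 ≤ B ∧ ∀ k i, ‖u k i‖ ≤ B := by
  obtain ⟨B, hB⟩ := (Metric.isBounded_range_of_tendsto u (tendsto_pi_nhds.2 h)).exists_norm_le
  have hB' : ∀ k, ‖u k‖ ≤ B := fun k => hB _ ⟨k, rfl⟩
  exact ⟨B, (norm_nonneg _).trans (hB' 0), fun k i => (norm_le_pi_norm (u k) i).trans (hB' k)⟩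

lemma exists_inv_d_le_of_tendsto (hn : 2 ≤ n) {u : ℕ → Fin n → ℂ} {ξ : Fin n → ℂ}
    (hξ : Tendsto u atTop (𝓝 ξ)) (hinj : Function.Injective ξ) :
    ∃ B, 0 ≤ B ∧ ∀ k i, (d (u k) i)⁻¹ ≤ B := by
  have hlim := tendsto_pi_nhds.1 hξ
  obtain ⟨B, hB0, hB⟩ := exists_norm_le_of_tendsto (ι := Fin n × Fin n)
    (u := fun k ij => (u k ij.1 - u k ij.2)⁻¹)
    (l := fun ij => (ξ ij.1 - ξ ij.2)⁻¹) (fun ij => by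
      rcases eq_or_ne ij.1 ij.2 with h | h
      -- a pair of equal indices contributes `0⁻¹ = 0`
      · simp [h]
      · exact ((hlim _).sub (hlim _)).inv₀ (sub_ne_zero.2 (hinj.ne h)))
  refine ⟨B, hB0, fun k i => ?_⟩
  obtain ⟨j, -, h⟩ := exists_eq_d hn (u k) i
  rw [h, ← norm_inv]
  exact hB k (i, j)

lemma exists_norm_W_iter_le (hn : 2 ≤ n) (hf : f.Monic) (hdeg : f.natDegree = n) (hp : 1 ≤ p)
    (hpq : 1 / p + 1 / q = 1) (hz : IsAdmissible p q f z) {ξ : Fin n → ℂ}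
    (hξ : Tendsto (iter f z) atTop (𝓝 ξ)) (hinj : Function.Injective ξ) :
    ∃ K, 0 ≤ K ∧ ∀ k i, ‖W f (iter f z k) i‖ ≤ K * ‖iter f z k i - ξ i‖ := by
  have hlim := tendsto_pi_nhds.1 hξ
  obtain ⟨K, hK0, hK⟩ := exists_norm_le_of_tendsto (ι := Fin n)
    (u := fun k i => (∏ j ∈ Finset.univ.erase i, (iter f z k i - ξ j)) /
      ∏ j ∈ Finset.univ.erase i, (iter f z k i - iter f z k j))
    (l := fun i => (∏ j ∈ Finset.univ.erase i, (ξ i - ξ j)) /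
      ∏ j ∈ Finset.univ.erase i, (ξ i - ξ j)) (fun i =>
      (tendsto_finsetProd _ fun j _ => (hlim i).sub_const _).div
        (tendsto_finsetProd _ fun j _ => (hlim i).sub (hlim j)) (prod_erase_sub_ne_zero hinj i))
  refine ⟨K, hK0, fun k i => ?_⟩
  have heval : f.eval (iter f z k i) = ∏ j, (iter f z k i - ξ j) := by
    have h := congrArg (eval (iter f z k i)) (eq_prod_of_tendsto hn hf hdeg hp hpq hz hξ)
    simpa only [eval_prod, eval_sub, eval_X, eval_C] using h
  rw [W, heval, ← Finset.mul_prod_erase _ _ (Finset.mem_univ i), mul_div_assoc, norm_mul, mul_comm]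
  exact mul_le_mul_of_nonneg_right (hK k i) (norm_nonneg _)

/-- When `φ(E(z)) < 1`, the next correction is `O(E³)` times the present one, both the corrections
and `E` are bounded by multiples of the error, and the error is bounded by a multiple of the
correction; hence order four. -/
lemma convergesWithOrder_four (hn : 2 ≤ n) (hf : f.Monic) (hdeg : f.natDegree = n) (hp : 1 ≤ p)
    (hpq : 1 / p + 1 / q = 1) (hz : IsAdmissible p q f z) (hphi : phi n q (E p f z) < 1)
    {ξ : Fin n → ℂ} (hξ : Tendsto (iter f z) atTop (𝓝 ξ)) :
    ConvergesWithOrder p 4 (iter f z) ξ := by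
  have hx0 : 0 ≤ E p f z := E_nonneg hp
  have hinj := injective_of_tendsto hn hf hdeg hp hpq hz hphi hξ
  obtain ⟨B, hB0, hB⟩ := exists_inv_d_le_of_tendsto hn hξ hinj
  obtain ⟨K, hK0, hK⟩ := exists_norm_W_iter_le hn hf hdeg hp hpq hz hξ hinj
  have hr := psi_mul_pow_phi_lt_one hn hx0 hz.E_lt hz.phi_le one_ne_zero
  rw [pow_one] at hr
  have hA0 := psiPhiCoeff_nonneg hn hx0 hz.E_lt
  set A := psiPhiCoeff n q (E p f z)
  set M := mu n q (E p f z) / (1 - psi n q (E p f z) * phi n q (E p f z)) with hM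
  have hM0 : 0 ≤ M := div_nonneg (mu_pos hn hx0 hz.E_lt).le (by linarith)
  refine ⟨hξ, M * A * (B * K) ^ 3 * K, fun k => ?_⟩
  have hk := isAdmissible_iter hn hf hdeg hp hpq hz k
  have hk1 := isAdmissible_iter hn hf hdeg hp hpq hz (k + 1)
  have hpn := pnorm_nonneg hp (iter f z k - ξ)
  have hE : E p f (iter f z k) ≤ B * K * pnorm p (iter f z k - ξ) := by
    refine pnorm_le_mul hp (by positivity) fun i => ?_
    rw [norm_W_div_d hn hk.injective, ratio, div_eq_inv_mul, mul_assoc]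
    exact mul_le_mul (hB k i) (hK k i) (norm_nonneg _) hB0
  have hstep : ∀ i, ‖iter f z (k + 1) i - ξ i‖ ≤ M * ‖W f (iter f z (k + 1)) i‖ := by
    intro i
    have hlim : Tendsto (iter f (iter f z (k + 1))) atTop (𝓝 ξ) := by
      have := hξ.comp (tendsto_add_atTop_nat (k + 1))
      refine this.congr fun j => ?_
      rw [Function.comp_apply, add_comm, iter_add]
    have hle := E_iter_le_E hn hf hdeg hp hpq hz (k + 1)
    have hpp := psi_mul_phi_le_pow_mul (q := q) hn le_rfl hx0 hz.E_lt
      (E_nonneg hp (f := f) (z := iter f z (k + 1))) (by rwa [mul_one])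
    rw [one_pow, one_mul] at hpp
    refine (norm_sub_lim_le hn hf hdeg hp hpq hk1 hlim i).trans
      (mul_le_mul_of_nonneg_right ?_ (norm_nonneg _))
    exact div_le_div₀ (mu_pos hn hx0 hz.E_lt).le (mu_le_mu hn (E_nonneg hp) hle hz.E_lt)
      (by linarith) (by linarith)
  have hcoeff : psi n q (E p f (iter f z k)) * phi n q (E p f (iter f z k)) ≤
      (B * K * pnorm p (iter f z k - ξ)) ^ 3 * A := by
    rw [psi_mul_phi_eq hn (E_nonneg hp) hk.E_lt]
    exact mul_le_mul (pow_le_pow_left₀ (E_nonneg hp) hE 3)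
      (psiPhiCoeff_le_psiPhiCoeff hn (E_nonneg hp) (E_iter_le_E hn hf hdeg hp hpq hz k) hz.E_lt)
      (psiPhiCoeff_nonneg hn (E_nonneg hp) hk.E_lt) (by positivity)
  calc pnorm p (iter f z (k + 1) - ξ)
      ≤ M * ((B * K * pnorm p (iter f z k - ξ)) ^ 3 * A * K) * pnorm p (iter f z k - ξ) := by
        refine pnorm_le_mul hp (by positivity) fun i => ?_
        have h1 := (norm_W_G_le hn hf hdeg hp hpq hk.injective hk.E_lt i).trans
          (mul_le_mul hcoeff (hK k i) (norm_nonneg _) (by positivity))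
        refine (hstep i).trans ((mul_le_mul_of_nonneg_left h1 hM0).trans (le_of_eq ?_))
        rw [Pi.sub_apply]
        ring
    _ = _ := by ring

end Iterates

end Nourein

theorem mainTheorem3 (n : ℕ) (hn : 2 ≤ n) (f : ℂ[X]) (hf : f.Monic) (hdeg : f.natDegree = n)
    (p q : ℝ≥0∞) (hp : 1 ≤ p) (hpq : 1 / p + 1 / q = 1)
    (z0 : Fin n → ℂ) (hz0 : Function.Injective z0)
    (hE : Nourein.E p f z0 < Nourein.R n q)
    (hphi : Nourein.phi n q (Nourein.E p f z0) ≤ 1) :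
    (∀ k, Nourein.IsDefinedAt f (Nourein.iter f z0 k)) ∧
    ∃ ξ : Fin n → ℂ,
      Nourein.IsRootVector f ξ ∧
      Tendsto (Nourein.iter f z0) atTop (𝓝 ξ) ∧
      (Nourein.phi n q (Nourein.E p f z0) < 1 →
        Nourein.ConvergesWithOrder p 4 (Nourein.iter f z0) ξ) ∧
      -- the a priori estimate; `(4 ^ k - 1) / 3` is an exact division of natural numbers
      (∀ k : ℕ, 1 ≤ k →
        let lam := Nourein.phi n q (Nourein.E p f z0)
        let theta := Nourein.psi n q (Nourein.E p f z0)
        let muk := Nourein.mu n q (Nourein.E p f z0 * lam ^ ((4 ^ k - 1) / 3))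
        0 < 1 - theta * lam ^ (4 ^ k) ∧
        Nourein.pnorm p (Nourein.iter f z0 k - ξ) ≤
          muk * (theta ^ k * lam ^ ((4 ^ k - 1) / 3) / (1 - theta * lam ^ (4 ^ k))) *
            Nourein.pnorm p (Nourein.W f z0)) ∧
      -- the a posteriori estimate
      (∀ k : ℕ,
        let zk := Nourein.iter f z0 k
        let lamk := Nourein.phi n q (Nourein.E p f zk)
        let thetak := Nourein.psi n q (Nourein.E p f zk)
        let muk := Nourein.mu n q (Nourein.E p f zk)
        Nourein.E p f zk < Nourein.R n q ∧
        0 < 1 - thetak * lamk ∧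
        Nourein.pnorm p (zk - ξ) ≤
          muk / (1 - thetak * lamk) * Nourein.pnorm p (Nourein.W f zk)) := by
  have hz : Nourein.IsAdmissible p q f z0 := ⟨hz0, hE, hphi⟩
  have hadm := Nourein.isAdmissible_iter hn hf hdeg hp hpq hz
  obtain ⟨ξ, hξ⟩ := Nourein.exists_tendsto_iter hn hf hdeg hp hpq hz
  have hx0 : 0 ≤ Nourein.E p f z0 := Nourein.E_nonneg hp
  refine ⟨fun k => Nourein.isDefinedAt hn hp hpq (hadm k).injective (hadm k).E_lt, ξ,
    Nourein.isRootVector_of_tendsto hn hf hdeg hp hpq hz hξ, hξ,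
    fun h => Nourein.convergesWithOrder_four hn hf hdeg hp hpq hz h hξ, ?_, ?_⟩
  · intro k _ lam theta muk
    have hlam : 0 ≤ lam := Nourein.phi_nonneg hn hx0 hE
    have htheta : 0 < theta := Nourein.psi_pos hn hx0 hE
    have hmuk : 0 < muk := Nourein.mu_pos hn (by positivity)
      ((mul_le_of_le_one_right hx0 (pow_le_one₀ hlam hphi)).trans_lt hE)
    have hlt : 0 < 1 - theta * lam ^ 4 ^ k := sub_pos.2
      (Nourein.psi_mul_pow_phi_lt_one hn hx0 hE hphi (pow_ne_zero k four_ne_zero))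
    exact ⟨hlt, Nourein.pnorm_le_mul hp (by positivity)
      (Nourein.norm_iter_sub_le hn hf hdeg hp hpq hz hξ k)⟩
  · intro k zk lamk thetak muk
    have hk : Nourein.IsAdmissible p q f zk := hadm k
    have hmuk : 0 < muk := Nourein.mu_pos hn (Nourein.E_nonneg hp) hk.E_lt
    have hlt : 0 < 1 - thetak * lamk := by
      have := Nourein.psi_mul_pow_phi_lt_one hn (Nourein.E_nonneg hp) hk.E_lt hk.phi_le one_ne_zero
      rw [pow_one] at this
      exact sub_pos.2 this
    have hlim : Tendsto (Nourein.iter f zk) atTop (𝓝 ξ) := by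
      refine (hξ.comp (tendsto_add_atTop_nat k)).congr fun j => ?_
      rw [Function.comp_apply, add_comm, Nourein.iter_add]
    exact ⟨hk.E_lt, hlt, Nourein.pnorm_le_mul hp (by positivity)
      (Nourein.norm_sub_lim_le hn hf hdeg hp hpq hk hlim)⟩
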